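/- Let $d\ge 2$, let $\langle\cdot,\cdot\rangle$ and $\|\cdot\|$ be the Euclidean inner product and norm on $\mathbb{R}^d$, let $\vec w\in\mathbb{R}^d\setminus\{0\}$, and let $\mathfrak{p}:[0,+\infty)\to\mathbb{R}^d$ be a function such that the limit $\mathfrak{P}:=\lim_{\tau\to+\infty}\mathfrak{p}(\tau)/\sqrt{\tau}$ exists in $\mathbb{R}^d$. Then, for every (complex-valued) Schwartz function $k$ on $\mathbb{R}^d$, the integrals below converge absolutely and $$\lim_{\tau\to+\infty}\tau^{\frac{d-1}{2}}\int_{\mathbb{R}^d}\frac{k(u)\,e^{-i\langle u,\,\tau\vec w+\mathfrak{p}(\tau)\rangle}}{-i\langle\vec w,u\rangle+\|u\|^2}\,du=\frac{2\,\pi^{\frac{d+1}{2}}}{\|\vec w\|}\,k(0)\,\exp\left(-\frac{\|\mathfrak{P}\|^2\|\vec w\|^2-\langle\mathfrak{P},\vec w\rangle^2}{4\|\vec w\|^2}\right).$$ -/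

import Mathlib

/-!
Write `z(u) = -i⟪w, u⟫ + ‖u‖²` for the denominator (`resolventSymbol`). Since `Re z ≥ 0`, one has
`1 / z = ∫₀^∞ exp (-s z) ds`, so the integral under study is `∫₀^∞ F(s) ds`, where, with
`q = τ w + p(τ)`,
`F(s) = ∫ k(u) exp (-s‖u‖² - i⟪u, q - s w⟫) du`.
In dimension two the double integral is not absolutely convergent, so
`integral_Ioi_gaussianTransform` truncates at `s = T` and lets `T → ∞` by dominated convergence; the
majorant is `2 |k| / |z|`. That `k / z` is integrable
(`integrable_schwartz_div_resolventSymbol`) is where the dimension is used: `|z|` dominates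
`|u₀|^(2/3) |u₁|^(2/3)` for two orthogonal coordinates `u₀`, `u₁` with `u₀` along `w`.

Put `k = 𝓕 f`. Moving the Fourier transform onto the Gaussian turns `F(s)` into the average
`(π / s)^(d/2) ∫ f(y) exp (-‖q - s w + 2πy‖² / (4s)) dy` (`gaussianTransform`), to which absolute
estimates apply, and which concentrates on `|s - τ| ≲ √τ`.

* For `s ≤ τ / 2` the point `q - s w` has norm at least a multiple of `τ`, while the heat kernel and
  `f` both decay rapidly; hence `F(s) = O(τ^(-N))` for each `N`
  (`exists_pow_mul_norm_gaussianTransform_le`), and this range contributes nothing.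
* For `s > τ / 2` substitute `s = τ + √τ σ`. The rescaled integrand (`rescaledTransform`) converges
  pointwise in `σ` to `π^(d/2) (∫ f) exp (-‖P - σ w‖² / 4)` and is dominated by a multiple of
  `1 / (1 + σ²)` (`exists_norm_rescaledTransform_le`). The one-dimensional Gaussian integral of the
  limit gives the stated constant, because `∫ f = k 0`.
-/

open MeasureTheory Filter Topology Set Module
open scoped SchwartzMap FourierTransform RealInnerProductSpace

/-! ### The symbol and the integrability of its reciprocal -/

section
variable {V : Type*} [NormedAddCommGroup V] [InnerProductSpace ℝ V]

/-- The denominator `-i⟪w, u⟫ + ‖u‖²`, as a function of the frequency `u`. -/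
def resolventSymbol (w u : V) : ℂ :=
  -Complex.I * ((inner ℝ w u : ℝ) : ℂ) + ((‖u‖ ^ 2 : ℝ) : ℂ)

lemma resolventSymbol_re (w u : V) : (resolventSymbol w u).re = ‖u‖ ^ 2 := by
  simp [resolventSymbol, -Complex.ofReal_pow]

lemma resolventSymbol_im (w u : V) : (resolventSymbol w u).im = -inner ℝ w u := by
  simp [resolventSymbol, -Complex.ofReal_pow]

lemma resolventSymbol_ne_zero (w : V) {u : V} (hu : u ≠ 0) : resolventSymbol w u ≠ 0 := by
  intro h
  have := congrArg Complex.re h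
  rw [resolventSymbol_re] at this
  simp [hu] at this

lemma continuous_resolventSymbol (w : V) : Continuous (resolventSymbol w) := by
  unfold resolventSymbol
  fun_prop

/-- Geometric interpolation between `|⟪w, u⟫| ≤ |z|` and `‖u‖² ≤ |z|`. The weights `2/3` and `1/3`
give both factors the same exponent `2/3 < 1`, so that each is locally integrable along its own
coordinate after inversion. -/
lemma rpow_mul_rpow_le_norm_resolventSymbol (w u : V) :
    |inner ℝ w u| ^ (2 / 3 : ℝ) * ‖u‖ ^ (2 / 3 : ℝ) ≤ ‖resolventSymbol w u‖ := by
  set z := ‖resolventSymbol w u‖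
  have hz : 0 ≤ z := norm_nonneg _
  have h1 : |inner ℝ w u| ≤ z := by
    simpa [resolventSymbol_im] using Complex.abs_im_le_norm (resolventSymbol w u)
  have h2 : ‖u‖ ^ 2 ≤ z := by
    simpa [resolventSymbol_re] using Complex.abs_re_le_norm (resolventSymbol w u)
  calc |inner ℝ w u| ^ (2 / 3 : ℝ) * ‖u‖ ^ (2 / 3 : ℝ)
      = |inner ℝ w u| ^ (2 / 3 : ℝ) * (‖u‖ ^ 2) ^ (1 / 3 : ℝ) := by
        rw [← Real.rpow_natCast, ← Real.rpow_mul (norm_nonneg u)]; norm_num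
    _ ≤ z ^ (2 / 3 : ℝ) * z ^ (1 / 3 : ℝ) := by gcongr
    _ = z := by
        rw [← Real.rpow_add_of_nonneg hz (by norm_num) (by norm_num)]; norm_num

variable [FiniteDimensional ℝ V] [MeasurableSpace V] [BorelSpace V]

lemma ae_inner_ne_zero {w : V} (hw : w ≠ 0) : ∀ᵐ u : V, inner ℝ w u ≠ 0 := by
  have h : volume (((ℝ ∙ w)ᗮ : Submodule ℝ V) : Set V) = 0 := by
    apply Measure.addHaar_submodule
    intro h
    have : w ∈ (ℝ ∙ w)ᗮ := h ▸ Submodule.mem_top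
    rw [Submodule.mem_orthogonal_singleton_iff_inner_right] at this
    simp [hw] at this
  rw [← compl_mem_ae_iff] at h
  filter_upwards [h] with u hu
  simpa [Submodule.mem_orthogonal_singleton_iff_inner_right] using hu

end

lemma integrable_abs_rpow_mul_inv_one_add_sq {a : ℝ} (ha : -1 < a) (ha' : a ≤ 0) :
    Integrable (fun x : ℝ => |x| ^ a * (1 + x ^ 2)⁻¹) := by
  have key : IntegrableOn (fun x : ℝ => x ^ a * (1 + x ^ 2)⁻¹) (Ioi 0) := by
    rw [← Ioc_union_Ioi_eq_Ioi zero_le_one]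
    have hm : Measurable (fun x : ℝ => x ^ a * (1 + x ^ 2)⁻¹) := by fun_prop
    refine IntegrableOn.union ?_ ?_
    · have h := (intervalIntegral.intervalIntegrable_rpow' (a := 0) (b := 1) ha).1
      refine Integrable.mono' h hm.aestronglyMeasurable ?_
      refine (ae_restrict_iff' measurableSet_Ioc).2 (.of_forall fun x hx => ?_)
      have hx0 := hx.1
      rw [Real.norm_of_nonneg (by positivity)]
      exact mul_le_of_le_one_right (by positivity)
        (inv_le_one_of_one_le₀ (by nlinarith [sq_nonneg x]))
    · refine Integrable.mono' integrable_inv_one_add_sq.integrableOn hm.aestronglyMeasurable ?_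
      refine (ae_restrict_iff' measurableSet_Ioi).2 (.of_forall fun x (hx : 1 < x) => ?_)
      rw [Real.norm_of_nonneg (by positivity)]
      exact mul_le_of_le_one_left (by positivity) (Real.rpow_le_one_of_one_le_of_nonpos hx.le ha')
  have := (integrable_fun_norm_addHaar (E := ℝ) volume
    (f := fun x : ℝ => x ^ a * (1 + x ^ 2)⁻¹)).2 (by simpa using key)
  simpa using this

section
variable {V : Type*} [NormedAddCommGroup V] [InnerProductSpace ℝ V]

lemma SchwartzMap.exists_norm_le_prod_repr {ι : Type*} [Fintype ι] (b : OrthonormalBasis ι ℝ V)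
    (k : 𝓢(V, ℂ)) : ∃ C, ∀ u, ‖k u‖ ≤ C * ∏ i, (1 + (b.repr u i) ^ 2)⁻¹ := by
  have hb := fun u => one_add_le_sup_seminorm_apply (𝕜 := ℝ)
    (m := (2 * Fintype.card ι, 0)) le_rfl le_rfl k u
  refine ⟨2 ^ (2 * Fintype.card ι) * (Finset.Iic (2 * Fintype.card ι, 0)).sup
    (fun m => SchwartzMap.seminorm ℝ m.1 m.2) k, fun u => ?_⟩
  rw [Finset.prod_inv_distrib, ← div_eq_mul_inv, le_div_iff₀ (by positivity)]
  refine le_trans ?_ (hb u)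
  rw [norm_iteratedFDeriv_zero, mul_comm]
  gcongr
  rw [pow_mul, Fintype.card, ← Finset.prod_const]
  gcongr with i _
  have h1 : |b.repr u i| ≤ ‖u‖ := by
    simpa using PiLp.norm_apply_le (b.repr u) i
  have := sq_le_sq.2 (by simpa using h1 : |b.repr u i| ≤ |‖u‖|)
  nlinarith [norm_nonneg u]

variable [FiniteDimensional ℝ V]

lemma exists_orthonormalBasis_apply_eq_smul {n : ℕ} [NeZero n] (hn : finrank ℝ V = n)
    {w : V} (hw : w ≠ 0) :
    ∃ b : OrthonormalBasis (Fin n) ℝ V, b 0 = ‖w‖⁻¹ • w := by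
  have : Orthonormal ℝ (({0} : Set (Fin n)).domRestrict fun _ => ‖w‖⁻¹ • w) := by
    constructor
    · intro i
      simp [Set.domRestrict, norm_smul, hw]
    · intro i j hij
      exact absurd (Subsingleton.elim i j) hij
  obtain ⟨b, hb⟩ := this.exists_orthonormalBasis_extension_of_card_eq (by simpa using hn)
  exact ⟨b, hb 0 rfl⟩

variable [MeasurableSpace V] [BorelSpace V]

lemma OrthonormalBasis.integrable_prod_repr {ι : Type*} [Fintype ι] (b : OrthonormalBasis ι ℝ V)
    {f : ι → ℝ → ℝ} (hf : ∀ i, Integrable (f i)) :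
    Integrable (fun u : V => ∏ i, f i (b.repr u i)) := by
  have h := (PiLp.volume_preserving_ofLp ι).comp b.measurePreserving_repr
  exact h.integrable_comp_of_integrable (Integrable.fintype_prod hf)

theorem integrable_schwartz_div_resolventSymbol (hV : 2 ≤ finrank ℝ V) {w : V} (hw : w ≠ 0)
    (k : 𝓢(V, ℂ)) : Integrable (fun u => k u / resolventSymbol w u) := by
  obtain ⟨n, hn⟩ : ∃ n, finrank ℝ V = n + 2 := ⟨_, (Nat.sub_add_cancel hV).symm⟩
  obtain ⟨b, hb⟩ := exists_orthonormalBasis_apply_eq_smul hn hw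
  obtain ⟨C, hC⟩ := k.exists_norm_le_prod_repr b
  let a : Fin (n + 2) → ℝ := fun i => if i = 0 ∨ i = 1 then -(2 / 3) else 0
  have hint := (b.integrable_prod_repr (f := fun i x => |x| ^ a i * (1 + x ^ 2)⁻¹) fun i =>
    integrable_abs_rpow_mul_inv_one_add_sq (a := a i)
      (by dsimp [a]; split_ifs <;> norm_num) (by dsimp [a]; split_ifs <;> norm_num)).const_mul
      (C * ‖w‖ ^ (-(2 / 3) : ℝ))
  refine hint.mono' (k.continuous.measurable.div
    (continuous_resolventSymbol w).measurable).aestronglyMeasurable ?_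
  -- On the two coordinate hyperplanes the negative powers take the junk value `0 ^ (-2/3) = 0`, and
  -- the bound may fail; they are null sets.
  filter_upwards [ae_inner_ne_zero hw, ae_inner_ne_zero (b.toBasis.ne_zero 1)] with u h0 h1
  have hu0 : |inner ℝ w u| = ‖w‖ * |b.repr u 0| := by
    rw [b.repr_apply_apply, hb, inner_smul_left]
    simp [abs_mul]
    field_simp
  rw [OrthonormalBasis.coe_toBasis, ← b.repr_apply_apply] at h1
  have hw' : 0 < ‖w‖ := norm_pos_iff.2 hw
  have hr0 : 0 < |b.repr u 0| := by
    have := abs_pos.2 h0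
    rw [hu0] at this
    exact pos_of_mul_pos_right this hw'.le
  have hr1 : 0 < |b.repr u 1| := abs_pos.2 h1
  have hle : |b.repr u 1| ≤ ‖u‖ := by simpa using PiLp.norm_apply_le (b.repr u) 1
  have hz : ‖w‖ ^ (2 / 3 : ℝ) * |b.repr u 0| ^ (2 / 3 : ℝ) * |b.repr u 1| ^ (2 / 3 : ℝ)
      ≤ ‖resolventSymbol w u‖ := by
    refine le_trans ?_ (rpow_mul_rpow_le_norm_resolventSymbol w u)
    rw [hu0, Real.mul_rpow hw'.le hr0.le]
    gcongr
  have hprod : ∏ i, |b.repr u i| ^ a i =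
      |b.repr u 0| ^ (-(2 / 3) : ℝ) * |b.repr u 1| ^ (-(2 / 3) : ℝ) := by
    rw [Fin.prod_univ_succ, Fin.prod_univ_succ]
    have : ∀ i : Fin n, a i.succ.succ = 0 := fun i => if_neg (by
      rw [Fin.ext_iff, Fin.ext_iff, Fin.val_succ, Fin.val_succ, Fin.val_zero, Fin.val_one]
      omega)
    have h0 : a 0 = -(2 / 3) := if_pos (Or.inl rfl)
    have h1 : a 1 = -(2 / 3) := if_pos (Or.inr rfl)
    rw [Finset.prod_eq_one fun i _ => by rw [this i, Real.rpow_zero], mul_one,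
      Fin.succ_zero_eq_one, h0, h1]
  rw [Finset.prod_mul_distrib, hprod, norm_div, div_eq_mul_inv]
  calc ‖k u‖ * ‖resolventSymbol w u‖⁻¹
      ≤ (C * ∏ i, (1 + (b.repr u i) ^ 2)⁻¹) *
        (‖w‖ ^ (2 / 3 : ℝ) * |b.repr u 0| ^ (2 / 3 : ℝ) * |b.repr u 1| ^ (2 / 3 : ℝ))⁻¹ := by
        gcongr
        · exact (norm_nonneg _).trans (hC u)
        · exact hC u
    _ = _ := by
        rw [Real.rpow_neg hw'.le, Real.rpow_neg hr0.le, Real.rpow_neg hr1.le, mul_inv, mul_inv]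
        ring
end

/-! ### Gaussian regularisation and its Fourier representation -/

section
variable {V : Type*} [NormedAddCommGroup V] [InnerProductSpace ℝ V]
  [FiniteDimensional ℝ V] [MeasurableSpace V] [BorelSpace V]

/-- The average of `f` against the Gaussian of variance of order `s` centred at `-x / (2π)`. For
`s > 0` it equals `∫ 𝓕 f u * exp (-s‖u‖² - i⟪u, x⟫) du`, see `integral_fourier_mul_gaussian`; the
factors `2π` come from the normalisation of Mathlib's Fourier transform. -/
noncomputable def gaussianTransform (f : 𝓢(V, ℂ)) (s : ℝ) (x : V) : ℂ :=
  (((Real.pi / s) ^ (finrank ℝ V / 2 : ℝ) : ℝ) : ℂ) *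
    ∫ y, f y * (Real.exp (-‖x + (2 * Real.pi) • y‖ ^ 2 / (4 * s)) : ℂ)

lemma fourier_gaussian_mul_exp_inner {s : ℝ} (hs : 0 < s) (x y : V) :
    𝓕 (fun u : V => Complex.exp (-s * ‖u‖ ^ 2 - Complex.I * (inner ℝ u x : ℝ))) y =
      (((Real.pi / s) ^ (finrank ℝ V / 2 : ℝ) : ℝ) : ℂ) *
        (Real.exp (-‖x + (2 * Real.pi) • y‖ ^ 2 / (4 * s)) : ℂ) := by
  have hpi : (Real.pi : ℂ) ≠ 0 := by exact_mod_cast Real.pi_ne_zero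
  have hpi' : Real.pi ≠ 0 := Real.pi_ne_zero
  have h := fourier_gaussian_innerProductSpace' (V := V) (b := (s : ℂ)) (by simpa using hs)
    (-(2 * Real.pi)⁻¹ • x) y
  have e1 : (fun u : V => Complex.exp (-s * ‖u‖ ^ 2 - Complex.I * (inner ℝ u x : ℝ))) =
      fun u : V => Complex.exp (-s * ‖u‖ ^ 2 +
        2 * Real.pi * Complex.I * (inner ℝ (-(2 * Real.pi)⁻¹ • x) u : ℝ)) := by
    funext u
    rw [inner_smul_left, real_inner_comm]
    congr 1
    simp
    field_simp
    ring
  rw [e1, h]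
  have e2 : -(2 * Real.pi)⁻¹ • x - y = -((2 * Real.pi)⁻¹ • (x + (2 * Real.pi) • y)) := by
    rw [smul_add, smul_smul, inv_mul_cancel₀ (by positivity), one_smul, neg_smul]
    abel
  rw [e2, norm_neg, norm_smul, Real.norm_of_nonneg (by positivity)]
  congr 1
  · rw [Complex.ofReal_cpow (by positivity)]
    simp
  · rw [Complex.ofReal_exp]
    congr 1
    push_cast
    field_simp
    ring

lemma integrable_exp_neg_mul_norm_sq {b : ℝ} (hb : 0 < b) :
    Integrable fun u : V => Real.exp (-b * ‖u‖ ^ 2) := by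
  have := (GaussianFourier.integrable_cexp_neg_mul_sq_norm_add (V := V) (b := b)
    (by simpa using hb) 0 0).norm
  refine this.congr (.of_forall fun u => ?_)
  simp [Complex.norm_exp, ← Complex.ofReal_pow, ← Complex.ofReal_mul]

/-- The Fourier transform is moved from `f` to the Gaussian, by Fubini's theorem. -/
theorem integral_fourier_mul_gaussian (f : 𝓢(V, ℂ)) {s : ℝ} (hs : 0 < s) (x : V) :
    ∫ u, (𝓕 f) u * Complex.exp (-s * ‖u‖ ^ 2 - Complex.I * (inner ℝ u x : ℝ)) =
      gaussianTransform f s x := by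
  set g : V → ℂ := fun u => Complex.exp (-s * ‖u‖ ^ 2 - Complex.I * (inner ℝ u x : ℝ)) with hg
  have hgi : Integrable g := by
    refine (integrable_exp_neg_mul_norm_sq (V := V) hs).mono'
      (Continuous.aestronglyMeasurable (by fun_prop)) (.of_forall fun u => ?_)
    simp [hg, Complex.norm_exp, ← Complex.ofReal_pow, ← Complex.ofReal_mul]
  have h := VectorFourier.integral_fourierIntegral_smul_eq_flip (L := innerₗ V)
    Real.continuous_fourierChar continuous_inner (f.integrable (μ := volume)) hgi
  have hflip : (innerₗ V).flip = innerₗ V := by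
    ext a b; simp
  rw [hflip] at h
  change ∫ u, 𝓕 (f : V → ℂ) u • g u = ∫ u, f u • 𝓕 g u at h
  simp only [smul_eq_mul] at h
  rw [SchwartzMap.fourier_coe]
  refine h.trans ?_
  rw [gaussianTransform, ← integral_const_mul]
  refine integral_congr_ae (.of_forall fun y => ?_)
  simp only [hg]
  rw [fourier_gaussian_mul_exp_inner hs x y]
  ring

lemma norm_gaussianTransform_le (f : 𝓢(V, ℂ)) {s : ℝ} (hs : 0 < s) (x : V) :
    ‖gaussianTransform f s x‖ ≤ ∫ u, ‖(𝓕 f) u‖ := by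
  rw [← integral_fourier_mul_gaussian f hs x]
  refine norm_integral_le_of_norm_le (𝓕 f).integrable.norm (.of_forall fun u => ?_)
  rw [norm_mul]
  refine mul_le_of_le_one_right (norm_nonneg _) ?_
  rw [Complex.norm_exp, Real.exp_le_one_iff]
  simp [← Complex.ofReal_pow, ← Complex.ofReal_mul]
  positivity

/-- The Gaussian in this lemma has twice the variance of the one in `gaussianTransform`: this is
what remains after half of the exponent has been spent on absorbing a power, as in
`pow_mul_exp_neg_sq_le`. -/
lemma integral_exp_neg_norm_add_smul_sq {s : ℝ} (hs : 0 < s) (x : V) :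
    (Integrable fun y : V => Real.exp (-‖x + (2 * Real.pi) • y‖ ^ 2 / (8 * s))) ∧
    (Real.pi / s) ^ (finrank ℝ V / 2 : ℝ) *
      ∫ y : V, Real.exp (-‖x + (2 * Real.pi) • y‖ ^ 2 / (8 * s)) =
      2 ^ (finrank ℝ V / 2 : ℝ) := by
  have hpi := Real.pi_pos
  have e : ∀ y : V, Real.exp (-‖x + (2 * Real.pi) • y‖ ^ 2 / (8 * s)) =
      Real.exp (-(Real.pi ^ 2 / (2 * s)) * ‖y + (2 * Real.pi)⁻¹ • x‖ ^ 2) := by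
    intro y
    have : x + (2 * Real.pi) • y = (2 * Real.pi) • (y + (2 * Real.pi)⁻¹ • x) := by
      rw [smul_add, smul_smul, mul_inv_cancel₀ (by positivity), one_smul, add_comm]
    rw [this, norm_smul, Real.norm_of_nonneg (by positivity)]
    congr 1
    field_simp
    ring
  simp_rw [e]
  have hb : 0 < Real.pi ^ 2 / (2 * s) := by positivity
  refine ⟨(integrable_exp_neg_mul_norm_sq hb).comp_add_right _, ?_⟩
  rw [integral_add_right_eq_self (fun y : V => Real.exp (-(Real.pi ^ 2 / (2 * s)) * ‖y‖ ^ 2)),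
    GaussianFourier.integral_rexp_neg_mul_sq_norm hb,
    ← Real.mul_rpow (by positivity) (by positivity)]
  congr 1
  field_simp

lemma pow_mul_exp_neg_sq_le (N : ℕ) (r : ℝ) {s : ℝ} (hs : 0 < s) :
    r ^ (2 * N) * Real.exp (-r ^ 2 / (4 * s)) ≤
      (8 ^ N * N.factorial) * s ^ N * Real.exp (-r ^ 2 / (8 * s)) := by
  have h := Real.pow_div_factorial_le_exp (x := r ^ 2 / (8 * s)) (by positivity) N
  rw [div_le_iff₀ (by positivity)] at h
  have e : Real.exp (-r ^ 2 / (4 * s)) =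
      Real.exp (-r ^ 2 / (8 * s)) * Real.exp (-(r ^ 2 / (8 * s))) := by
    rw [← Real.exp_add]; congr 1; field_simp; ring
  have e2 : r ^ (2 * N) = (r ^ 2 / (8 * s)) ^ N * (8 ^ N * s ^ N) := by
    rw [← mul_pow, ← mul_pow, pow_mul]; congr 1; field_simp
  rw [e, e2]
  calc _ = ((r ^ 2 / (8 * s)) ^ N * Real.exp (-(r ^ 2 / (8 * s)))) *
        (8 ^ N * s ^ N * Real.exp (-r ^ 2 / (8 * s))) := by ring
    _ ≤ N.factorial * (8 ^ N * s ^ N * Real.exp (-r ^ 2 / (8 * s))) := by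
        gcongr
        rw [Real.exp_neg, ← div_eq_mul_inv, div_le_iff₀ (Real.exp_pos _)]
        linarith
    _ = _ := by ring

/-- Rapid decay in `x` of the Gaussian average, with a loss that is polynomial in the width `s`.
It comes from `‖x‖ ≤ ‖x + 2πy‖ + 2π‖y‖`: powers of the first term are absorbed by the Gaussian,
powers of the second by the Schwartz function. -/
theorem exists_pow_mul_norm_gaussianTransform_le (f : 𝓢(V, ℂ)) (N : ℕ) :
    ∃ C, 0 ≤ C ∧ ∀ s : ℝ, 0 < s → ∀ x : V,
      ‖x‖ ^ (2 * N) * ‖gaussianTransform f s x‖ ≤ C * (1 + s ^ N) := by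
  obtain ⟨A, hA, hfA⟩ := f.decay 0 0
  obtain ⟨B, hB, hfB⟩ := f.decay (2 * N) 0
  simp only [norm_iteratedFDeriv_zero, pow_zero, one_mul] at hfA hfB
  set c := 2 ^ (2 * N - 1) * (A * (8 ^ N * N.factorial) + (2 * Real.pi) ^ (2 * N) * B) with hc
  have hpi := Real.pi_pos
  have hc0 : 0 ≤ c := by positivity
  refine ⟨c * 2 ^ (finrank ℝ V / 2 : ℝ), by positivity, fun s hs x => ?_⟩
  obtain ⟨hi, he⟩ := integral_exp_neg_norm_add_smul_sq hs x
  have key : ∀ y : V, ‖x‖ ^ (2 * N) *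
      ‖f y * (Real.exp (-‖x + (2 * Real.pi) • y‖ ^ 2 / (4 * s)) : ℂ)‖
      ≤ c * (1 + s ^ N) * Real.exp (-‖x + (2 * Real.pi) • y‖ ^ 2 / (8 * s)) := by
    intro y
    set r := ‖x + (2 * Real.pi) • y‖ with hr
    have hr0 : 0 ≤ r := norm_nonneg _
    have hx : ‖x‖ ≤ r + 2 * Real.pi * ‖y‖ := by
      calc ‖x‖ = ‖(x + (2 * Real.pi) • y) - (2 * Real.pi) • y‖ := by rw [add_sub_cancel_right]
        _ ≤ _ := (norm_sub_le _ _).trans_eq (by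
          rw [norm_smul, Real.norm_of_nonneg (by positivity)])
    have h1 : ‖x‖ ^ (2 * N) ≤
        2 ^ (2 * N - 1) * (r ^ (2 * N) + (2 * Real.pi) ^ (2 * N) * ‖y‖ ^ (2 * N)) := by
      rw [← mul_pow]
      exact (pow_le_pow_left₀ (norm_nonneg _) hx _).trans
        (add_pow_le hr0 (by positivity) _)
    have h2 : Real.exp (-r ^ 2 / (4 * s)) ≤ Real.exp (-r ^ 2 / (8 * s)) := by
      rw [Real.exp_le_exp, neg_div, neg_div, neg_le_neg_iff]
      gcongr
      norm_num
    have h3 := pow_mul_exp_neg_sq_le N r hs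
    set G := Real.exp (-r ^ 2 / (4 * s))
    set H := Real.exp (-r ^ 2 / (8 * s))
    have hG : 0 < G := Real.exp_pos _
    have hH : 0 < H := Real.exp_pos _
    have hsN : 0 < s ^ N := by positivity
    rw [norm_mul, Complex.norm_real, Real.norm_of_nonneg hG.le]
    calc ‖x‖ ^ (2 * N) * (‖f y‖ * G)
        ≤ (2 ^ (2 * N - 1) * (r ^ (2 * N) + (2 * Real.pi) ^ (2 * N) * ‖y‖ ^ (2 * N))) *
            (‖f y‖ * G) := by gcongr
      _ = 2 ^ (2 * N - 1) * (‖f y‖ * (r ^ (2 * N) * G) +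
            (2 * Real.pi) ^ (2 * N) * (‖y‖ ^ (2 * N) * ‖f y‖) * G) := by ring
      _ ≤ 2 ^ (2 * N - 1) * (A * ((8 ^ N * N.factorial) * s ^ N * H) +
            (2 * Real.pi) ^ (2 * N) * B * H) := by
          gcongr
          · exact hfA y
          · exact hfB y
      _ = 2 ^ (2 * N - 1) * (A * (8 ^ N * N.factorial) * s ^ N +
            (2 * Real.pi) ^ (2 * N) * B * 1) * H := by ring
      _ ≤ 2 ^ (2 * N - 1) * (A * (8 ^ N * N.factorial) * (1 + s ^ N) +
            (2 * Real.pi) ^ (2 * N) * B * (1 + s ^ N)) * H := by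
          gcongr <;> linarith
      _ = _ := by rw [hc]; ring
  rw [gaussianTransform, norm_mul, Complex.norm_real, Real.norm_of_nonneg (by positivity)]
  have h4 : ‖x‖ ^ (2 * N) *
      ‖∫ y, f y * (Real.exp (-‖x + (2 * Real.pi) • y‖ ^ 2 / (4 * s)) : ℂ)‖ ≤
      c * (1 + s ^ N) * ∫ y : V, Real.exp (-‖x + (2 * Real.pi) • y‖ ^ 2 / (8 * s)) := by
    rw [← integral_const_mul]
    calc _ = ‖∫ y, (‖x‖ ^ (2 * N) : ℝ) •
          (f y * (Real.exp (-‖x + (2 * Real.pi) • y‖ ^ 2 / (4 * s)) : ℂ))‖ := by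
          rw [integral_smul, norm_smul, Real.norm_of_nonneg (by positivity)]
      _ ≤ _ := norm_integral_le_of_norm_le (hi.const_mul _) (.of_forall fun y => by
          rw [norm_smul, Real.norm_of_nonneg (by positivity)]
          exact key y)
  calc _ = (Real.pi / s) ^ (finrank ℝ V / 2 : ℝ) * (‖x‖ ^ (2 * N) *
      ‖∫ y, f y * (Real.exp (-‖x + (2 * Real.pi) • y‖ ^ 2 / (4 * s)) : ℂ)‖) := by ring
    _ ≤ (Real.pi / s) ^ (finrank ℝ V / 2 : ℝ) * (c * (1 + s ^ N) *
      ∫ y : V, Real.exp (-‖x + (2 * Real.pi) • y‖ ^ 2 / (8 * s))) := by gcongr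
    _ = c * (1 + s ^ N) * ((Real.pi / s) ^ (finrank ℝ V / 2 : ℝ) *
      ∫ y : V, Real.exp (-‖x + (2 * Real.pi) • y‖ ^ 2 / (8 * s))) := by ring
    _ = _ := by rw [he]; ring

lemma measurable_gaussianTransform_line (f : 𝓢(V, ℂ)) (q w : V) :
    Measurable fun s : ℝ => gaussianTransform f s (q - s • w) := by
  unfold gaussianTransform
  refine Measurable.mul (by fun_prop) ?_
  refine StronglyMeasurable.measurable (StronglyMeasurable.integral_prod_right
    (f := fun (s : ℝ) (y : V) =>
      f y * (Real.exp (-‖q - s • w + (2 * Real.pi) • y‖ ^ 2 / (4 * s)) : ℂ)) ?_)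
  refine Measurable.stronglyMeasurable ?_
  have := f.continuous.measurable
  unfold Function.uncurry
  fun_prop
end

/-! ### Integration over the regularisation parameter -/

section
variable {V : Type*} [NormedAddCommGroup V] [InnerProductSpace ℝ V]

lemma norm_exp_neg_mul_resolventSymbol_le {s : ℝ} (hs : 0 ≤ s) (w u : V) :
    ‖Complex.exp (-(s * resolventSymbol w u))‖ ≤ 1 := by
  rw [Complex.norm_exp, Real.exp_le_one_iff, Complex.neg_re, Complex.re_ofReal_mul,
    resolventSymbol_re]
  nlinarith [mul_nonneg hs (sq_nonneg ‖u‖)]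

lemma tendsto_exp_neg_mul_resolventSymbol (w : V) {u : V} (hu : u ≠ 0) :
    Tendsto (fun T : ℝ => Complex.exp (-(T * resolventSymbol w u))) atTop (𝓝 0) := by
  rw [tendsto_zero_iff_norm_tendsto_zero]
  have : 0 < ‖u‖ ^ 2 := by positivity
  simp_rw [Complex.norm_exp, Complex.neg_re, Complex.re_ofReal_mul, resolventSymbol_re]
  exact Real.tendsto_exp_neg_atTop_nhds_zero.comp (tendsto_id.atTop_mul_const this)

variable [FiniteDimensional ℝ V] [MeasurableSpace V] [BorelSpace V]

lemma norm_exp_neg_I_mul (a : ℝ) : ‖Complex.exp (-Complex.I * (a : ℂ))‖ = 1 := by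
  rw [Complex.norm_exp]; simp

lemma integral_exp_neg_mul {z : ℂ} (hz : z ≠ 0) {T : ℝ} :
    ∫ s in (0 : ℝ)..T, Complex.exp (-(s * z)) = (1 - Complex.exp (-(T * z))) / z := by
  have h := integral_exp_mul_complex (a := 0) (b := T) (neg_ne_zero.2 hz)
  have e : ∀ s : ℝ, -(s * z) = -z * s := fun s => by ring
  simp_rw [e, h]
  rw [div_neg, ← neg_div]
  simp

/-- On a bounded range of `s` the double integral converges absolutely, and Fubini's theorem
applies. -/
lemma intervalIntegral_gaussianTransform (f : 𝓢(V, ℂ)) (q w : V) {T : ℝ} (hT : 0 ≤ T)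
    [Nontrivial V] :
    ∫ s in (0 : ℝ)..T, gaussianTransform f s (q - s • w) =
      ∫ u, (𝓕 f) u * Complex.exp (-Complex.I * (inner ℝ u q : ℝ)) *
        ((1 - Complex.exp (-(T * resolventSymbol w u))) / resolventSymbol w u) := by
  set k : 𝓢(V, ℂ) := 𝓕 f with hk
  have hki : Integrable k := k.integrable
  have hkc : Continuous k := k.continuous
  have hzc := continuous_resolventSymbol w
  rw [intervalIntegral.integral_of_le hT]
  have e1 : ∫ s in Ioc 0 T, gaussianTransform f s (q - s • w) =
      ∫ s in Ioc 0 T, ∫ u, k u * Complex.exp (-Complex.I * (inner ℝ u q : ℝ)) *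
        Complex.exp (-(s * resolventSymbol w u)) := by
    refine setIntegral_congr_fun measurableSet_Ioc fun s hs => ?_
    rw [← integral_fourier_mul_gaussian f hs.1]
    refine integral_congr_ae (.of_forall fun u => ?_)
    simp only [mul_assoc, ← Complex.exp_add]
    congr 2
    rw [resolventSymbol, inner_sub_right, inner_smul_right, real_inner_comm u w]
    push_cast
    ring
  rw [e1, integral_integral_swap]
  · refine integral_congr_ae ?_
    filter_upwards [Measure.ae_ne volume (0 : V)] with u hu
    rw [integral_const_mul, ← intervalIntegral.integral_of_le hT,
      integral_exp_neg_mul (resolventSymbol_ne_zero w hu)]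
  · refine (hki.norm.comp_snd (volume.restrict (Ioc 0 T))).mono'
      (Continuous.aestronglyMeasurable (by unfold Function.uncurry; fun_prop)) ?_
    have : ∀ᵐ z : ℝ × V ∂((volume.restrict (Ioc 0 T)).prod volume), z.1 ∈ Ioc 0 T :=
      Measure.quasiMeasurePreserving_fst.ae (ae_restrict_mem measurableSet_Ioc)
    filter_upwards [this] with z hz
    simp only [Function.uncurry, norm_mul, norm_exp_neg_I_mul, mul_one]
    exact mul_le_of_le_one_right (norm_nonneg _)
      (norm_exp_neg_mul_resolventSymbol_le hz.1.le w z.2)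

lemma integrable_fourier_mul_exp_div (hV : 2 ≤ finrank ℝ V) {w : V} (hw : w ≠ 0)
    (k : 𝓢(V, ℂ)) (q : V) :
    Integrable fun u => k u * Complex.exp (-Complex.I * (inner ℝ u q : ℝ)) /
      resolventSymbol w u := by
  refine (integrable_schwartz_div_resolventSymbol hV hw k).norm.mono'
    (Measurable.aestronglyMeasurable ?_) (.of_forall fun u => ?_)
  · have := k.continuous.measurable
    have := (continuous_resolventSymbol w).measurable
    fun_prop
  · rw [norm_div, norm_mul, norm_exp_neg_I_mul, mul_one, norm_div]

/-- The integral under study, written as an integral over the regularisation parameter `s`. The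
truncation error carries the factor `exp (-T z)`, which tends to `0` away from `u = 0`. -/
theorem integral_Ioi_gaussianTransform (hV : 2 ≤ finrank ℝ V) {w : V} (hw : w ≠ 0)
    (f : 𝓢(V, ℂ)) (q : V)
    (hF : IntegrableOn (fun s => gaussianTransform f s (q - s • w)) (Ioi 0)) :
    ∫ s in Ioi 0, gaussianTransform f s (q - s • w) =
      ∫ u, (𝓕 f) u * Complex.exp (-Complex.I * (inner ℝ u q : ℝ)) / resolventSymbol w u := by
  have : Nontrivial V := nontrivial_of_ne w 0 hw
  have hzm := (continuous_resolventSymbol w).measurable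
  have key := fun T (hT : 0 ≤ T) => intervalIntegral_gaussianTransform f q w (T := T) hT
  generalize (𝓕 f : 𝓢(V, ℂ)) = k at key ⊢
  have hkm := k.continuous.measurable
  refine tendsto_nhds_unique (intervalIntegral_tendsto_integral_Ioi 0 hF tendsto_id) ?_
  refine Tendsto.congr' (f₁ := fun T : ℝ =>
    ∫ u, k u * Complex.exp (-Complex.I * (inner ℝ u q : ℝ)) *
        ((1 - Complex.exp (-(T * resolventSymbol w u))) / resolventSymbol w u)) ?_ ?_
  · filter_upwards [eventually_ge_atTop 0] with T hT
    exact (key T hT).symm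
  refine tendsto_integral_filter_of_dominated_convergence
    (fun u => 2 * ‖k u / resolventSymbol w u‖) ?_ ?_
    ((integrable_schwartz_div_resolventSymbol hV hw _).norm.const_mul 2) ?_
  · exact .of_forall fun T => Measurable.aestronglyMeasurable (by fun_prop)
  · filter_upwards [eventually_ge_atTop 0] with T hT
    refine .of_forall fun u => ?_
    rw [norm_mul, norm_mul, norm_exp_neg_I_mul, mul_one, norm_div, norm_div]
    have : ‖1 - Complex.exp (-(T * resolventSymbol w u))‖ ≤ 2 := by
      refine (norm_sub_le _ _).trans ?_
      have := norm_exp_neg_mul_resolventSymbol_le hT w u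
      rw [norm_one]; linarith
    calc _ ≤ ‖k u‖ * (2 / ‖resolventSymbol w u‖) := by gcongr
      _ = _ := by ring
  · filter_upwards [Measure.ae_ne volume (0 : V)] with u hu
    have h := ((tendsto_exp_neg_mul_resolventSymbol w hu).const_sub 1).div_const
      (resolventSymbol w u)
    have := h.const_mul (k u * Complex.exp (-Complex.I * (inner ℝ u q : ℝ)))
    rw [sub_zero, mul_one_div] at this
    exact this
end

/-! ### The rescaled far part -/

/-- The scalar estimate behind the domination in `σ`. Where `|σ| W` is large compared with `A`,
the exponent is at least of the order of `σ² / (1 + |σ|)`, because the width `1 + ε σ` is at most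
`1 + |σ|`; elsewhere `σ` is itself controlled by `A`. -/
lemma exp_neg_sq_div_le {W A r ε σ : ℝ} (hW : 0 < W) (hε : 0 ≤ ε) (hε1 : ε ≤ 1)
    (ht : 1 / 2 < 1 + ε * σ) (hσ : |σ| * W ≤ r + A) :
    Real.exp (-r ^ 2 / (4 * (1 + ε * σ))) ≤
      (1 + 2 / W ^ 2 * (8 + 64 / W ^ 2 + 2 * A ^ 2)) * (1 + σ ^ 2)⁻¹ := by
  set t := 1 + ε * σ with htdef
  have htle : t ≤ 1 + |σ| := by
    have : ε * σ ≤ |σ| := by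
      calc ε * σ ≤ ε * |σ| := by gcongr; exact le_abs_self σ
        _ ≤ |σ| := mul_le_of_le_one_left (abs_nonneg _) hε1
    linarith
  have ht0 : 0 < t := by linarith
  set E := r ^ 2 / (4 * t) with hE
  have hE0 : 0 ≤ E := by positivity
  have hr2 : r ^ 2 = 4 * t * E := by rw [hE]; field_simp
  have hneg : -r ^ 2 / (4 * t) = -E := by rw [hE, neg_div]
  rw [hneg]
  have h1 : σ ^ 2 * W ^ 2 ≤ 2 * r ^ 2 + 2 * A ^ 2 := by
    have : (|σ| * W) ^ 2 ≤ (r + A) ^ 2 := by gcongr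
    rw [mul_pow, sq_abs] at this
    nlinarith [sq_nonneg (r - A)]
  -- Young's inequality; half of the left side of `h1` can then absorb the term linear in `|σ|`.
  have h2 : 8 * (|σ| * E) ≤ σ ^ 2 * W ^ 2 / 2 + 32 * E ^ 2 / W ^ 2 := by
    have h : 0 ≤ (|σ| * W - 8 * E / W) ^ 2 := sq_nonneg _
    have e : (|σ| * W - 8 * E / W) ^ 2 = σ ^ 2 * W ^ 2 - 16 * (|σ| * E) + 64 * E ^ 2 / W ^ 2 := by
      rw [← sq_abs σ]; field_simp; ring
    rw [e] at h
    have : 64 * E ^ 2 / W ^ 2 = 2 * (32 * E ^ 2 / W ^ 2) := by ring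
    linarith
  have h3 : σ ^ 2 ≤ 2 / W ^ 2 * (8 * E + 32 / W ^ 2 * E ^ 2 + 2 * A ^ 2) := by
    have : σ ^ 2 * W ^ 2 ≤ 2 * (8 * E + 32 / W ^ 2 * E ^ 2 + 2 * A ^ 2) := by
      have h4 : t * E ≤ (1 + |σ|) * E := by gcongr
      have h5 : 32 * E ^ 2 / W ^ 2 = 32 / W ^ 2 * E ^ 2 := by ring
      nlinarith
    rw [div_mul_eq_mul_div, le_div_iff₀ (by positivity)]
    exact this
  have hx0 : Real.exp (-E) ≤ 1 := Real.exp_le_one_iff.2 (by linarith)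
  have hexp := Real.exp_pos (-E)
  have hx1 : E * Real.exp (-E) ≤ 1 := by
    have := Real.pow_div_factorial_le_exp (x := E) hE0 1
    rw [Real.exp_neg, ← div_eq_mul_inv, div_le_one (Real.exp_pos _)]
    simpa using this
  have hx2 : E ^ 2 * Real.exp (-E) ≤ 2 := by
    have := Real.pow_div_factorial_le_exp (x := E) hE0 2
    rw [Real.exp_neg, ← div_eq_mul_inv, div_le_iff₀ (Real.exp_pos _)]
    simp at this
    linarith
  rw [← div_eq_mul_inv, le_div_iff₀ (by positivity)]
  calc Real.exp (-E) * (1 + σ ^ 2)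
      ≤ Real.exp (-E) * (1 + 2 / W ^ 2 * (8 * E + 32 / W ^ 2 * E ^ 2 + 2 * A ^ 2)) := by gcongr
    _ = Real.exp (-E) + 2 / W ^ 2 * (8 * (E * Real.exp (-E)) +
        32 / W ^ 2 * (E ^ 2 * Real.exp (-E)) + 2 * A ^ 2 * Real.exp (-E)) := by ring
    _ ≤ 1 + 2 / W ^ 2 * (8 * 1 + 32 / W ^ 2 * 2 + 2 * A ^ 2 * 1) := by gcongr
    _ = _ := by ring

section
variable {V : Type*} [NormedAddCommGroup V] [InnerProductSpace ℝ V]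

lemma integral_exp_neg_norm_sub_smul_sq {w : V} (hw : w ≠ 0) (P : V) :
    ∫ σ : ℝ, Real.exp (-‖P - σ • w‖ ^ 2 / 4) = 2 * Real.sqrt Real.pi / ‖w‖ *
      Real.exp (-((‖P‖ ^ 2 * ‖w‖ ^ 2 - (inner ℝ P w) ^ 2) / (4 * ‖w‖ ^ 2))) := by
  have hW : 0 < ‖w‖ := norm_pos_iff.2 hw
  have e : ∀ σ : ℝ, Real.exp (-‖P - σ • w‖ ^ 2 / 4) =
      Real.exp (-((‖P‖ ^ 2 * ‖w‖ ^ 2 - (inner ℝ P w) ^ 2) / (4 * ‖w‖ ^ 2))) *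
      Real.exp (-(‖w‖ ^ 2 / 4) * (σ - inner ℝ P w / ‖w‖ ^ 2) ^ 2) := by
    intro σ
    rw [← Real.exp_add, norm_sub_sq_real, inner_smul_right, norm_smul, mul_pow,
      Real.norm_eq_abs, sq_abs]
    congr 1
    field_simp
    ring
  simp_rw [e]
  rw [integral_const_mul, integral_sub_right_eq_self
    (fun σ : ℝ => Real.exp (-(‖w‖ ^ 2 / 4) * σ ^ 2)), integral_gaussian]
  have : Real.sqrt (Real.pi / (‖w‖ ^ 2 / 4)) = 2 * Real.sqrt Real.pi / ‖w‖ := by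
    rw [show Real.pi / (‖w‖ ^ 2 / 4) = Real.pi * (2 / ‖w‖) ^ 2 by field_simp; ring,
      Real.sqrt_mul Real.pi_pos.le, Real.sqrt_sq (by positivity)]
    ring
  rw [this, mul_comm]

variable [FiniteDimensional ℝ V] [MeasurableSpace V] [BorelSpace V]

/-- The function `σ ↦ τ^(d/2) F(τ + √τ σ)` with `ε = 1 / √τ` and `q = p(τ) / √τ`, cut off to the
range `s > τ / 2`, that is `1 + ε σ > 1 / 2`; here `F(s) = gaussianTransform f s (τ w + p(τ) - s
w)`. See `rescaledTransform_eq`. In this form `ε = 0` is allowed, and gives the limit. -/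
noncomputable def rescaledTransform (f : 𝓢(V, ℂ)) (w : V) (ε : ℝ) (q : V) : ℝ → ℂ :=
  {σ : ℝ | 1 / 2 < 1 + ε * σ}.indicator fun σ =>
    (((Real.pi / (1 + ε * σ)) ^ (finrank ℝ V / 2 : ℝ) : ℝ) : ℂ) *
      ∫ y, f y * (Real.exp (-‖q - σ • w + (2 * Real.pi * ε) • y‖ ^ 2 / (4 * (1 + ε * σ))) : ℂ)

lemma measurable_rescaledTransform (f : 𝓢(V, ℂ)) (w : V) (ε : ℝ) (q : V) :
    Measurable (rescaledTransform f w ε q) := by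
  refine Measurable.indicator ?_ (measurableSet_lt (by fun_prop) (by fun_prop))
  refine Measurable.mul (by fun_prop) ?_
  refine StronglyMeasurable.measurable (StronglyMeasurable.integral_prod_right
    (f := fun (σ : ℝ) (y : V) => f y *
      (Real.exp (-‖q - σ • w + (2 * Real.pi * ε) • y‖ ^ 2 / (4 * (1 + ε * σ))) : ℂ)) ?_)
  refine Measurable.stronglyMeasurable ?_
  have := f.continuous.measurable
  unfold Function.uncurry
  fun_prop

lemma exists_norm_rescaledTransform_le (f : 𝓢(V, ℂ)) {w : V} (hw : w ≠ 0) (M : ℝ) :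
    ∃ D, ∀ ε : ℝ, 0 ≤ ε → ε ≤ 1 → ∀ q : V, ‖q‖ ≤ M → ∀ σ : ℝ,
      ‖rescaledTransform f w ε q σ‖ ≤ D * (1 + σ ^ 2)⁻¹ := by
  have hpi := Real.pi_pos
  have hW : 0 < ‖w‖ := norm_pos_iff.2 hw
  set B : V → ℝ := fun y => 1 + 2 / ‖w‖ ^ 2 *
    (8 + 64 / ‖w‖ ^ 2 + 2 * (M + 2 * Real.pi * ‖y‖) ^ 2) with hB
  have hB0 : ∀ y, 0 ≤ B y := fun y => by positivity
  have hint : Integrable fun y => ‖f y‖ * B y := by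
    have h0 := f.integrable_pow_mul volume 0
    have h1 := f.integrable_pow_mul volume 1
    have h2 := f.integrable_pow_mul volume 2
    have := ((h0.const_mul (1 + 2 / ‖w‖ ^ 2 * (8 + 64 / ‖w‖ ^ 2 + 2 * M ^ 2))).add
      (h1.const_mul (2 / ‖w‖ ^ 2 * (8 * Real.pi * M)))).add
      (h2.const_mul (2 / ‖w‖ ^ 2 * (8 * Real.pi ^ 2)))
    refine this.congr (.of_forall fun y => ?_)
    simp only [hB, Pi.add_apply]
    ring
  refine ⟨(2 * Real.pi) ^ (finrank ℝ V / 2 : ℝ) * ∫ y, ‖f y‖ * B y,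
    fun ε hε hε1 q hq σ => ?_⟩
  have hI0 : 0 ≤ ∫ y, ‖f y‖ * B y := integral_nonneg fun y => by have := hB0 y; positivity
  by_cases hσ : 1 / 2 < 1 + ε * σ
  · have ht0 : 0 < 1 + ε * σ := by linarith
    rw [rescaledTransform, indicator_of_mem (by exact hσ), norm_mul, Complex.norm_real,
      Real.norm_of_nonneg (by positivity), mul_assoc _ (∫ y, _)]
    refine mul_le_mul ?_ ?_ (norm_nonneg _) (by positivity)
    · gcongr
      rw [div_le_iff₀ ht0]; nlinarith
    · rw [← integral_mul_const]
      refine norm_integral_le_of_norm_le (hint.mul_const _) (.of_forall fun y => ?_)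
      rw [norm_mul, Complex.norm_real, Real.norm_of_nonneg (Real.exp_pos _).le, mul_assoc ‖f y‖]
      refine mul_le_mul_of_nonneg_left ?_ (norm_nonneg _)
      refine exp_neg_sq_div_le hW hε hε1 hσ ?_
      calc |σ| * ‖w‖ = ‖σ • w‖ := by rw [norm_smul, Real.norm_eq_abs]
        _ = ‖-(q - σ • w + (2 * Real.pi * ε) • y) + (q + (2 * Real.pi * ε) • y)‖ := by
          congr 1; abel
        _ ≤ ‖q - σ • w + (2 * Real.pi * ε) • y‖ + (‖q‖ + ‖(2 * Real.pi * ε) • y‖) :=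
          (norm_add_le _ _).trans (add_le_add (by rw [norm_neg]) (norm_add_le _ _))
        _ ≤ _ := by
          rw [norm_smul, Real.norm_of_nonneg (by positivity)]
          exact add_le_add_right (add_le_add hq (mul_le_mul_of_nonneg_right
            (mul_le_of_le_one_right (by positivity) hε1) (norm_nonneg y))) _
  · rw [rescaledTransform, indicator_of_notMem (by exact hσ), norm_zero]
    positivity

lemma integrable_rescaledTransform (f : 𝓢(V, ℂ)) {w : V} (hw : w ≠ 0) {ε : ℝ} (hε : 0 ≤ ε)
    (hε1 : ε ≤ 1) (q : V) : Integrable (rescaledTransform f w ε q) := by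
  obtain ⟨D, hD⟩ := exists_norm_rescaledTransform_le f hw ‖q‖
  exact (integrable_inv_one_add_sq.const_mul D).mono'
    (measurable_rescaledTransform f w ε q).aestronglyMeasurable
    (.of_forall fun σ => hD ε hε hε1 q le_rfl σ)

lemma tendsto_rescaledTransform (f : 𝓢(V, ℂ)) (w P : V) {l : Filter ℝ} [l.IsCountablyGenerated]
    {ε : ℝ → ℝ} {q : ℝ → V} (hε : Tendsto ε l (𝓝 0)) (hq : Tendsto q l (𝓝 P)) (σ : ℝ) :
    Tendsto (fun τ => rescaledTransform f w (ε τ) (q τ) σ) l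
      (𝓝 ((Real.pi ^ (finrank ℝ V / 2 : ℝ) : ℝ) *
        ((∫ y, f y) * (Real.exp (-‖P - σ • w‖ ^ 2 / 4) : ℂ)))) := by
  have ht : Tendsto (fun τ => 1 + ε τ * σ) l (𝓝 1) := by
    simpa using (hε.mul_const σ).const_add 1
  have hev : ∀ᶠ τ in l, 1 / 2 < 1 + ε τ * σ := ht.eventually_const_lt (by norm_num)
  have h1 : Tendsto (fun τ => (((Real.pi / (1 + ε τ * σ)) ^ (finrank ℝ V / 2 : ℝ) : ℝ) : ℂ)) l
      (𝓝 ((Real.pi ^ (finrank ℝ V / 2 : ℝ) : ℝ) : ℂ)) := by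
    have : Tendsto (fun τ => Real.pi / (1 + ε τ * σ)) l (𝓝 (Real.pi / 1)) :=
      tendsto_const_nhds.div ht one_ne_zero
    rw [div_one] at this
    exact (Complex.continuous_ofReal.tendsto _).comp
      (this.rpow_const (Or.inl Real.pi_ne_zero))
  have h2 : Tendsto (fun τ => ∫ y, f y *
      (Real.exp (-‖q τ - σ • w + (2 * Real.pi * ε τ) • y‖ ^ 2 / (4 * (1 + ε τ * σ))) : ℂ)) l
      (𝓝 ((∫ y, f y) * (Real.exp (-‖P - σ • w‖ ^ 2 / 4) : ℂ))) := by
    rw [← integral_mul_const]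
    refine tendsto_integral_filter_of_dominated_convergence (fun y => ‖f y‖) ?_ ?_
      f.integrable.norm ?_
    · have := f.continuous
      exact .of_forall fun τ => Continuous.aestronglyMeasurable (by fun_prop)
    · filter_upwards [hev] with τ hτ
      refine .of_forall fun y => ?_
      rw [norm_mul, Complex.norm_real, Real.norm_of_nonneg (Real.exp_pos _).le]
      refine mul_le_of_le_one_right (norm_nonneg _) (Real.exp_le_one_iff.2 ?_)
      exact div_nonpos_of_nonpos_of_nonneg (by simp) (by linarith)
    · refine .of_forall fun y => Tendsto.const_mul _ ?_
      refine (Complex.continuous_ofReal.tendsto _).comp ((Real.continuous_exp.tendsto _).comp ?_)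
      have ha : Tendsto (fun τ => q τ - σ • w + (2 * Real.pi * ε τ) • y) l (𝓝 (P - σ • w)) := by
        simpa using (hq.sub_const (σ • w)).add ((hε.const_mul (2 * Real.pi)).smul_const y)
      have := (ha.norm.pow 2).neg.div (ht.const_mul 4) (by norm_num)
      simpa [Pi.div_def] using this
  refine (h1.mul h2).congr' ?_
  filter_upwards [hev] with τ hτ
  rw [rescaledTransform, indicator_of_mem (by exact hτ)]

theorem tendsto_integral_rescaledTransform (f : 𝓢(V, ℂ)) {w : V} (hw : w ≠ 0) (P : V)
    {l : Filter ℝ} [l.IsCountablyGenerated] {ε : ℝ → ℝ} {q : ℝ → V} (hε0 : ∀ᶠ τ in l, 0 ≤ ε τ)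
    (hε : Tendsto ε l (𝓝 0)) (hq : Tendsto q l (𝓝 P)) :
    Tendsto (fun τ => ∫ σ, rescaledTransform f w (ε τ) (q τ) σ) l
      (𝓝 (((2 * Real.pi ^ (((finrank ℝ V : ℝ) + 1) / 2) / ‖w‖ : ℝ) : ℂ) * (∫ y, f y) *
        (Real.exp (-((‖P‖ ^ 2 * ‖w‖ ^ 2 - (inner ℝ P w) ^ 2) / (4 * ‖w‖ ^ 2))) : ℂ))) := by
  have hval : ((2 * Real.pi ^ (((finrank ℝ V : ℝ) + 1) / 2) / ‖w‖ : ℝ) : ℂ) * (∫ y, f y) *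
        (Real.exp (-((‖P‖ ^ 2 * ‖w‖ ^ 2 - (inner ℝ P w) ^ 2) / (4 * ‖w‖ ^ 2))) : ℂ) =
      ∫ σ : ℝ, ((Real.pi ^ (finrank ℝ V / 2 : ℝ) : ℝ) *
        ((∫ y, f y) * (Real.exp (-‖P - σ • w‖ ^ 2 / 4) : ℂ)) : ℂ) := by
    rw [integral_const_mul, integral_const_mul, integral_complex_ofReal,
      integral_exp_neg_norm_sub_smul_sq hw, add_div, Real.rpow_add Real.pi_pos,
      ← Real.sqrt_eq_rpow]
    push_cast
    ring
  rw [hval]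
  obtain ⟨D, hD⟩ := exists_norm_rescaledTransform_le f hw (‖P‖ + 1)
  refine tendsto_integral_filter_of_dominated_convergence (fun σ => D * (1 + σ ^ 2)⁻¹) ?_ ?_
    (integrable_inv_one_add_sq.const_mul D) ?_
  · exact .of_forall fun τ => (measurable_rescaledTransform f w _ _).aestronglyMeasurable
  · filter_upwards [hε0, hε.eventually_le_const zero_lt_one,
      hq.norm.eventually_le_const (lt_add_one ‖P‖)] with τ h0 h1 h2
    exact .of_forall fun σ => hD _ h0 h1 _ h2 σ
  · exact .of_forall fun σ => tendsto_rescaledTransform f w P hε hq σ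
end

/-! ### Assembly of the asymptotics -/

section
variable {V : Type*} [NormedAddCommGroup V] [InnerProductSpace ℝ V]
  [FiniteDimensional ℝ V] [MeasurableSpace V] [BorelSpace V]

lemma integrableOn_Ioc_gaussianTransform (f : 𝓢(V, ℂ)) (q w : V) (a : ℝ) :
    IntegrableOn (fun s => gaussianTransform f s (q - s • w)) (Ioc 0 a) := by
  refine Integrable.mono' (integrable_const (∫ u, ‖(𝓕 f) u‖))
    (measurable_gaussianTransform_line f q w).aestronglyMeasurable ?_
  exact (ae_restrict_iff' measurableSet_Ioc).2
    (.of_forall fun s hs => norm_gaussianTransform_le f hs.1 _)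

lemma rescaledTransform_eq (f : 𝓢(V, ℂ)) (w : V) {τ : ℝ} (hτ : 0 < τ) (p : V) (σ : ℝ) :
    rescaledTransform f w (√τ)⁻¹ ((√τ)⁻¹ • p) σ =
      ((τ ^ (finrank ℝ V / 2 : ℝ) : ℝ) : ℂ) * (Ioi (τ / 2)).indicator
        (fun s => gaussianTransform f s (τ • w + p - s • w)) (√τ * σ + τ) := by
  obtain ⟨r, hr, rfl⟩ : ∃ r : ℝ, 0 < r ∧ r ^ 2 = τ :=
    ⟨√τ, Real.sqrt_pos.2 hτ, Real.sq_sqrt hτ.le⟩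
  rw [Real.sqrt_sq hr.le]
  have ht : r * σ + r ^ 2 = r ^ 2 * (1 + r⁻¹ * σ) := by field_simp; ring
  have hmem : 1 / 2 < 1 + r⁻¹ * σ ↔ r ^ 2 / 2 < r * σ + r ^ 2 := by
    rw [ht, div_eq_mul_one_div (r ^ 2), mul_lt_mul_iff_right₀ hτ]
  by_cases h : 1 / 2 < 1 + r⁻¹ * σ
  · have ht0 : 0 < 1 + r⁻¹ * σ := by linarith
    rw [rescaledTransform, indicator_of_mem (by exact h), indicator_of_mem (by exact hmem.1 h),
      gaussianTransform, ← mul_assoc, ← Complex.ofReal_mul,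
      ← Real.mul_rpow (by positivity) (by rw [ht]; positivity)]
    congr 3
    · rw [ht]; field_simp
    · funext y
      have : r ^ 2 • w + p - (r * σ + r ^ 2) • w + (2 * Real.pi) • y =
          r • (r⁻¹ • p - σ • w + (2 * Real.pi * r⁻¹) • y) := by
        rw [smul_add, smul_sub, smul_smul, smul_smul, smul_smul, mul_inv_cancel₀ hr.ne', one_smul,
          add_smul, show r * (2 * Real.pi * r⁻¹) = 2 * Real.pi by field_simp]
        abel
      rw [this, norm_smul, Real.norm_of_nonneg hr.le, ht]
      congr 3
      field_simp
  · rw [rescaledTransform, indicator_of_notMem (by exact h),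
      indicator_of_notMem (by exact fun h' => h (hmem.2 h')), mul_zero]

lemma integrableOn_Ioi_half_gaussianTransform (f : 𝓢(V, ℂ)) {w : V} (hw : w ≠ 0) {τ : ℝ}
    (hτ : 1 ≤ τ) (p : V) :
    IntegrableOn (fun s => gaussianTransform f s (τ • w + p - s • w)) (Ioi (τ / 2)) := by
  have hτ0 : 0 < τ := by linarith
  have h := integrable_rescaledTransform f hw (ε := (√τ)⁻¹) (by positivity)
    (inv_le_one_of_one_le₀ (Real.one_le_sqrt.2 hτ)) ((√τ)⁻¹ • p)
  have hc : ((τ ^ (finrank ℝ V / 2 : ℝ) : ℝ) : ℂ) ≠ 0 := by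
    exact_mod_cast (Real.rpow_pos_of_pos hτ0 _).ne'
  rw [funext (rescaledTransform_eq f w hτ0 p),
    integrable_const_mul_iff (isUnit_iff_ne_zero.2 hc)] at h
  have h2 := (integrable_comp_mul_left_iff (fun s => (Ioi (τ / 2)).indicator
        (fun s => gaussianTransform f s (τ • w + p - s • w)) (s + τ))
        (Real.sqrt_pos.2 hτ0).ne').1 h
  have h3 := h2.comp_sub_right τ
  simp only [sub_add_cancel] at h3
  exact (integrable_indicator_iff measurableSet_Ioi).1 h3

lemma integral_Ioi_half_gaussianTransform (f : 𝓢(V, ℂ)) (w : V) {τ : ℝ} (hτ : 0 < τ) (p : V) :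
    ((τ ^ (((finrank ℝ V : ℝ) - 1) / 2) : ℝ) : ℂ) *
      ∫ s in Ioi (τ / 2), gaussianTransform f s (τ • w + p - s • w) =
    ∫ σ, rescaledTransform f w (√τ)⁻¹ ((√τ)⁻¹ • p) σ := by
  have hr := Real.sqrt_pos.2 hτ
  simp_rw [rescaledTransform_eq f w hτ p]
  rw [integral_const_mul, Measure.integral_comp_mul_left (fun s => (Ioi (τ / 2)).indicator
      (fun s => gaussianTransform f s (τ • w + p - s • w)) (s + τ)) (√τ),
    integral_add_right_eq_self, integral_indicator measurableSet_Ioi, Complex.real_smul,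
    ← mul_assoc, ← Complex.ofReal_mul]
  congr 2
  rw [abs_of_pos (by positivity), ← Real.rpow_neg_one, Real.sqrt_eq_rpow, ← Real.rpow_mul hτ.le,
    ← Real.rpow_add hτ]
  congr 1
  ring

lemma integrableOn_Ioi_gaussianTransform (f : 𝓢(V, ℂ)) {w : V} (hw : w ≠ 0) {τ : ℝ}
    (hτ : 1 ≤ τ) (p : V) :
    IntegrableOn (fun s => gaussianTransform f s (τ • w + p - s • w)) (Ioi 0) := by
  rw [← Ioc_union_Ioi_eq_Ioi (show (0 : ℝ) ≤ τ / 2 by linarith)]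
  exact (integrableOn_Ioc_gaussianTransform f _ w _).union
    (integrableOn_Ioi_half_gaussianTransform f hw hτ p)

/-- The range `s ≤ τ / 2` is negligible. With `N = d + 1` in the decay estimate, the contribution
is `O(τ^((d-1)/2) * τ * τ^(-(d+1))) = O(τ^(-(d+1)/2))`. -/
theorem tendsto_integral_Ioc_half_gaussianTransform (f : 𝓢(V, ℂ)) {w : V} (hw : w ≠ 0)
    {p : ℝ → V} {P : V} (hp : Tendsto (fun τ : ℝ => (√τ)⁻¹ • p τ) atTop (𝓝 P)) :
    Tendsto (fun τ : ℝ => ((τ ^ (((finrank ℝ V : ℝ) - 1) / 2) : ℝ) : ℂ) *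
      ∫ s in Ioc 0 (τ / 2), gaussianTransform f s (τ • w + p τ - s • w)) atTop (𝓝 0) := by
  have hW : 0 < ‖w‖ := norm_pos_iff.2 hw
  set n := finrank ℝ V
  obtain ⟨C, hC0, hC⟩ := exists_pow_mul_norm_gaussianTransform_le f (n + 1)
  set K := (‖w‖ / 4) ^ (2 * (n + 1)) with hK
  have hK0 : 0 < K := by positivity
  have hlim : Tendsto (fun τ : ℝ => C / K * τ ^ (-(((n : ℝ) + 1) / 2))) atTop (𝓝 0) := by
    simpa using (tendsto_rpow_neg_atTop (by positivity : 0 < ((n : ℝ) + 1) / 2)).const_mul (C / K)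
  refine squeeze_zero_norm' ?_ hlim
  have hsq : ∀ᶠ τ : ℝ in atTop, 4 * (‖P‖ + 1) / ‖w‖ ≤ √τ :=
    Real.tendsto_sqrt_atTop.eventually_ge_atTop _
  filter_upwards [eventually_ge_atTop 1, hsq,
    hp.norm.eventually_le_const (lt_add_one ‖P‖)] with τ hτ hτs hτp
  have hτ0 : 0 < τ := by linarith
  have hr := Real.sqrt_pos.2 hτ0
  -- Since `p(τ) = O(√τ)`, the drift `τ w` dominates.
  have hpτ : ‖p τ‖ ≤ τ * ‖w‖ / 4 := by
    rw [norm_smul, Real.norm_of_nonneg (by positivity), inv_mul_le_iff₀ hr] at hτp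
    rw [div_le_iff₀ hW] at hτs
    have hs := Real.mul_self_sqrt hτ0.le
    nlinarith
  have hbound : ∀ s ∈ Ioc 0 (τ / 2),
      ‖gaussianTransform f s (τ • w + p τ - s • w)‖ ≤ 2 * C / K * (τ ^ (n + 1))⁻¹ := by
    intro s hs
    have hx : τ * (‖w‖ / 4) ≤ ‖τ • w + p τ - s • w‖ := by
      have e : τ • w + p τ - s • w = (τ - s) • w + p τ := by rw [sub_smul]; abel
      have h1 := norm_sub_le ((τ - s) • w + p τ) (p τ)
      rw [add_sub_cancel_right, norm_smul, Real.norm_of_nonneg (by linarith [hs.2])] at h1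
      rw [e]
      nlinarith [hs.2]
    have h2 := hC s hs.1 (τ • w + p τ - s • w)
    have h3 : (τ * (‖w‖ / 4)) ^ (2 * (n + 1)) * ‖gaussianTransform f s (τ • w + p τ - s • w)‖ ≤
        C * (τ ^ (n + 1) + τ ^ (n + 1)) := by
      refine (mul_le_mul_of_nonneg_right (pow_le_pow_left₀ (by positivity) hx _)
        (norm_nonneg _)).trans (h2.trans ?_)
      have : s ≤ τ := by linarith [hs.2]
      have hs0 := hs.1.le
      gcongr
      exact one_le_pow₀ hτ
    rw [mul_pow, ← hK, show 2 * (n + 1) = (n + 1) + (n + 1) by ring, pow_add] at h3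
    rw [div_mul_eq_mul_div, le_div_iff₀ hK0, ← div_eq_mul_inv, le_div_iff₀ (by positivity)]
    have hT : 0 < τ ^ (n + 1) := by positivity
    refine le_of_mul_le_mul_left ?_ hT
    calc _ = τ ^ (n + 1) * τ ^ (n + 1) * K * ‖gaussianTransform f s (τ • w + p τ - s • w)‖ := by
          ring
      _ ≤ _ := h3
      _ = _ := by ring
  have hI := norm_setIntegral_le_of_norm_le_const (μ := volume) (s := Ioc 0 (τ / 2))
    (by simp) hbound
  rw [Real.volume_real_Ioc_of_le (by positivity), sub_zero] at hI
  rw [norm_mul, Complex.norm_real, Real.norm_of_nonneg (by positivity)]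
  calc _ ≤ τ ^ (((n : ℝ) - 1) / 2) * (2 * C / K * (τ ^ (n + 1))⁻¹ * (τ / 2)) := by gcongr
    _ = C / K * (τ ^ (((n : ℝ) - 1) / 2) * (τ ^ (n + 1))⁻¹ * τ) := by ring
    _ = _ := by
      rw [← Real.rpow_natCast, ← Real.rpow_neg hτ0.le, ← Real.rpow_add hτ0,
        ← Real.rpow_add_one hτ0.ne']
      congr 2
      push_cast
      ring
end

theorem proposition4 (d : ℕ) (hd : 2 ≤ d)
    (w : EuclideanSpace ℝ (Fin d)) (hw : w ≠ 0)
    (p : ℝ → EuclideanSpace ℝ (Fin d)) (P : EuclideanSpace ℝ (Fin d))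
    (hp : Filter.Tendsto (fun τ : ℝ => (Real.sqrt τ)⁻¹ • p τ) Filter.atTop (nhds P))
    (k : SchwartzMap (EuclideanSpace ℝ (Fin d)) ℂ) :
    (∀ τ : ℝ, MeasureTheory.Integrable
      (fun u : EuclideanSpace ℝ (Fin d) =>
        k u * Complex.exp (-Complex.I * ((inner ℝ u (τ • w + p τ) : ℝ) : ℂ)) /
          (-Complex.I * ((inner ℝ w u : ℝ) : ℂ) + ((‖u‖ ^ 2 : ℝ) : ℂ)))
      MeasureTheory.volume) ∧
    Filter.Tendsto
      (fun τ : ℝ =>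
        ((τ ^ (((d : ℝ) - 1) / 2) : ℝ) : ℂ) *
          ∫ u : EuclideanSpace ℝ (Fin d),
            k u * Complex.exp (-Complex.I * ((inner ℝ u (τ • w + p τ) : ℝ) : ℂ)) /
              (-Complex.I * ((inner ℝ w u : ℝ) : ℂ) + ((‖u‖ ^ 2 : ℝ) : ℂ)))
      Filter.atTop
      (nhds
        (((2 * Real.pi ^ (((d : ℝ) + 1) / 2) / ‖w‖ : ℝ) : ℂ) * k 0 *
          ((Real.exp (-((‖P‖ ^ 2 * ‖w‖ ^ 2 - (inner ℝ P w) ^ 2) / (4 * ‖w‖ ^ 2))) : ℝ) : ℂ))) := by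
  have hfin : finrank ℝ (EuclideanSpace ℝ (Fin d)) = d := finrank_euclideanSpace_fin
  have hV : 2 ≤ finrank ℝ (EuclideanSpace ℝ (Fin d)) := hfin.symm ▸ hd
  refine ⟨fun τ => integrable_fourier_mul_exp_div hV hw k (τ • w + p τ), ?_⟩
  obtain ⟨f, rfl⟩ : ∃ f : 𝓢(EuclideanSpace ℝ (Fin d), ℂ), 𝓕 f = k :=
    ⟨𝓕⁻ k, FourierTransform.fourier_fourierInv_eq k⟩
  have h0 : (𝓕 f) 0 = ∫ y, f y := by
    rw [SchwartzMap.fourier_coe, Real.fourier_eq']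
    simp
  have hε : Tendsto (fun τ : ℝ => (√τ)⁻¹) atTop (𝓝 0) :=
    tendsto_inv_atTop_zero.comp Real.tendsto_sqrt_atTop
  have hfar := tendsto_integral_rescaledTransform f hw P (l := atTop)
    (.of_forall fun τ : ℝ => by positivity) hε hp
  have hsum := (tendsto_integral_Ioc_half_gaussianTransform f hw hp).add hfar
  rw [zero_add, hfin, ← h0] at hsum
  refine hsum.congr' ?_
  filter_upwards [eventually_ge_atTop 1] with τ hτ
  have hτ0 : 0 < τ := by linarith
  rw [← integral_Ioi_half_gaussianTransform f w hτ0, hfin, ← mul_add,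
    ← setIntegral_union (Ioc_disjoint_Ioi le_rfl) measurableSet_Ioi
      (integrableOn_Ioc_gaussianTransform f _ w _)
      (integrableOn_Ioi_half_gaussianTransform f hw hτ (p τ)),
    Ioc_union_Ioi_eq_Ioi (by positivity), integral_Ioi_gaussianTransform hV hw f _
      (integrableOn_Ioi_gaussianTransform f hw hτ (p τ))]
  rfl
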